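/- Let $n_1,n_2,m_1,m_2$ be nonnegative integers, $q=\max\{n_1,n_2,m_1,m_2\}$, and let $D$ be the $q\times q$ down-shift matrix over $\mathbb{F}_2$ ($D_{j,k}=1$ if $j=k+1$, and $0$ otherwise). Consider the memoryless linear deterministic wiretap channel with side information whose outputs at time $i$ at the legitimate receiver ($k=1$) and at the eavesdropper ($k=2$) are $$Y_k[i]=D^{q-n_k}X[i]\oplus D^{q-m_k}S[i],\qquad k=1,2,$$ where $X[i]\in\mathbb{F}_2^q$ is the channel input and the interference vectors $S[i]\in\mathbb{F}_2^q$ are i.i.d. over time with i.i.d. Bernoulli-$1/2$ entries. A code of block length $n$ has a message $W$, uniform on a finite set of $M_n$ messages and independent of $S^n$; a (possibly randomized) encoder mapping $(W,S^n)$ to $X^n$, so that the interference is known non-causally at the transmitter; and a decoder producing an estimate $\hat W$ of $W$ from $Y_1^n$. A secrecy rate $R$ is achievable if there is a sequence of codes, of block lengths $n\to\infty$, with $\liminf_n \frac1n\log_2 M_n\ge R$, $\Pr(\hat W\neq W)\to 0$ and $\frac1n I(W;Y_2^n)\to 0$. The secrecy capacity $C_s$ is the largest achievable secrecy rate, in bits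 per channel use. Then this largest rate exists and $$C_s=\begin{cases} n_1, & \text{if } n_1-m_1\neq n_2-m_2 \text{ and } (n_1\le m_1 \text{ or } n_2\le m_2),\\ \max\{m_1,\;n_1-n_2+m_2\}, & \text{if } n_1-m_1\neq n_2-m_2,\ n_1>m_1 \text{ and } n_2>m_2,\\ (n_1-n_2)^+, & \text{if } n_1-m_1=n_2-m_2,\end{cases}$$ where $x^+=\max\{0,x\}$. -/

import Mathlib

open Filter Topology

noncomputable section

/-! ### Entropy and mutual information (in bits) of finite mass functions -/

/-- Shannon entropy, in bits, of a mass function on a finite type (with `0 log 0 = 0`). -/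
def entropyBits {α : Type*} [Fintype α] (p : α → ℝ) : ℝ :=
  ∑ a, Real.negMulLog (p a) / Real.log 2

/-- Mutual information `I(A;B) = H(A) + H(B) - H(A,B)`, in bits, of a pair of finitely valued
random variables with joint mass function `p`. -/
def mutualInfoBits {α β : Type*} [Fintype α] [Fintype β] (p : α → β → ℝ) : ℝ :=
  entropyBits (fun a => ∑ b, p a b) + entropyBits (fun b => ∑ a, p a b)
    - entropyBits (fun ab : α × β => p ab.1 ab.2)

/-! ### The discrete memoryless wiretap channel with side information -/

/-- A discrete memoryless wiretap channel with state: the law of one state symbol, and the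
transition probabilities `p(y₁, y₂ | x, s)`. -/
structure WiretapChannel (X S Y₁ Y₂ : Type*) where
  /-- the law of each state symbol -/
  stateLaw : PMF S
  /-- `transition x s` is the joint law of the two outputs given input `x` and state `s` -/
  transition : X → S → PMF (Y₁ × Y₂)

/-- A code of block length `n`. The encoder is randomized and sees the message together with the
whole state sequence (non-causal side information); the legitimate receiver decodes from its own
output sequence only. -/
structure WiretapCode (X S Y₁ : Type*) (n : ℕ) where
  /-- number of messages -/
  numMsg : ℕ
  numMsg_pos : 0 < numMsg
  /-- law of the channel input block given the message and the state block -/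
  encoder : Fin numMsg → (Fin n → S) → PMF (Fin n → X)
  decoder : (Fin n → Y₁) → Fin numMsg

namespace WiretapCode

variable {X S Y₁ Y₂ : Type*} {n : ℕ}

/-- Rate of a code, in bits per channel use. -/
def rate (c : WiretapCode X S Y₁ n) : ℝ :=
  Real.logb 2 c.numMsg / n

/-- The joint mass function of message, state block, input block and the two output blocks: the
message is uniform and independent of the i.i.d. state sequence, and the channel is memoryless. -/
def jointLaw (c : WiretapCode X S Y₁ n) (ch : WiretapChannel X S Y₁ Y₂)
    (w : Fin c.numMsg) (s : Fin n → S) (x : Fin n → X) (y₁ : Fin n → Y₁) (y₂ : Fin n → Y₂) : ℝ :=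
  (1 / (c.numMsg : ℝ)) * (∏ i, (ch.stateLaw (s i)).toReal) * (c.encoder w s x).toReal *
    ∏ i, (ch.transition (x i) (s i) (y₁ i, y₂ i)).toReal

variable [Fintype X] [Fintype S] [Fintype Y₁] [Fintype Y₂]

/-- The probability that the legitimate receiver decodes a wrong message. -/
def errorProb (c : WiretapCode X S Y₁ n) (ch : WiretapChannel X S Y₁ Y₂) : ℝ :=
  ∑ w, ∑ s, ∑ x, ∑ y₁, ∑ y₂, if c.decoder y₁ ≠ w then c.jointLaw ch w s x y₁ y₂ else 0

/-- The information leakage `I(W; Y₂ⁿ)` to the eavesdropper, in bits. -/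
def leakage (c : WiretapCode X S Y₁ n) (ch : WiretapChannel X S Y₁ Y₂) : ℝ :=
  mutualInfoBits fun w y₂ => ∑ s, ∑ x, ∑ y₁, c.jointLaw ch w s x y₁ y₂

end WiretapCode

namespace WiretapChannel

variable {X S Y₁ Y₂ : Type*} [Fintype X] [Fintype S] [Fintype Y₁] [Fintype Y₂]

/-- `R` is an achievable secrecy rate: some sequence of codes of block lengths `n = 0, 1, 2, …` has
asymptotic rate at least `R`, error probability tending to `0`, and `I(W; Y₂ⁿ) / n` tending
to `0`. -/
def Achievable (ch : WiretapChannel X S Y₁ Y₂) (R : ℝ) : Prop :=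
  ∃ c : (n : ℕ) → WiretapCode X S Y₁ n,
    (∀ ε : ℝ, 0 < ε → ∀ᶠ n in atTop, R - ε ≤ (c n).rate) ∧
    Tendsto (fun n => (c n).errorProb ch) atTop (𝓝 0) ∧
    Tendsto (fun n => (c n).leakage ch / n) atTop (𝓝 0)

/-- `C` is the secrecy capacity: the largest achievable secrecy rate. -/
def IsSecrecyCapacity (ch : WiretapChannel X S Y₁ Y₂) (C : ℝ) : Prop :=
  IsGreatest {R : ℝ | ch.Achievable R} C

end WiretapChannel

/-! ### The linear deterministic model -/

/-- The `q × q` down-shift matrix over the field with two elements: ones exactly on the first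
subdiagonal. -/
def downShift (q : ℕ) : Matrix (Fin q) (Fin q) (ZMod 2) :=
  Matrix.of fun j k => if (j : ℕ) = (k : ℕ) + 1 then 1 else 0

/-- The common length of the input and interference vectors. -/
abbrev maxGain (n₁ n₂ m₁ m₂ : ℕ) : ℕ := max (max n₁ n₂) (max m₁ m₂)

/-- Binary vectors of length `q`. -/
abbrev BinVec (q : ℕ) : Type := Fin q → ZMod 2

/-- One output of the linear deterministic model, `D^(q-n) x ⊕ D^(q-m) s`. -/
def linDetOutput (q n m : ℕ) (x s : BinVec q) : BinVec q :=
  Matrix.mulVec (downShift q ^ (q - n)) x + Matrix.mulVec (downShift q ^ (q - m)) s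

/-- The linear deterministic wiretap channel with side information,
`Y_k = D^(q-n_k) X ⊕ D^(q-m_k) S` for `k = 1, 2`, with `q = max {n₁, n₂, m₁, m₂}`. The entries of
the interference vector `S` are i.i.d. Bernoulli-1/2, that is, `S` is uniformly distributed. -/
def linDetChannel (n₁ n₂ m₁ m₂ : ℕ) :
    WiretapChannel (BinVec (maxGain n₁ n₂ m₁ m₂)) (BinVec (maxGain n₁ n₂ m₁ m₂))
      (BinVec (maxGain n₁ n₂ m₁ m₂)) (BinVec (maxGain n₁ n₂ m₁ m₂)) where
  stateLaw := PMF.uniformOfFintype _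
  transition x s :=
    PMF.pure (linDetOutput (maxGain n₁ n₂ m₁ m₂) n₁ m₁ x s,
      linDetOutput (maxGain n₁ n₂ m₁ m₂) n₂ m₂ x s)

end

/-! ### Mutual information of finite mass functions -/

/-! Index the rows of output `k` by the input bit `i` they carry: the row shows `x i + s (i + d_k)`
with `d_k = m_k - n_k`, where bits at negative positions are zero.

Achievability is one-shot with perfect secrecy. The encoder sends `w + s (i + d₁)` on bits `lo ≤ i <
n₁`, so the receiver reads `w` cleanly. The scheme is additive, so the eavesdropper's law does not
depend on `w` as soon as some translation `t` of the uniform state absorbs `w`: `w (i - lo) + t (i +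
d₁) + t (i + d₂) = 0`. If `d₁ ≠ d₂` this recursion is triangular (`exists_two_shift_solution`), and
it needs only `lo + max d₁ d₂ ≥ 0`. If `d₁ = d₂`, the bits the eavesdropper hears are left at zero,
`lo = n₂`.

The converse rests on a list form of Fano's inequality (`list_fano`): an observation that fixes `Y₁`
up to `|V|` values per use reveals all but `log |V|` bits per use. The state reveals nothing, which
gives `n₁`. The eavesdropper's output may reveal only `o(n)` bits, and it already contains every row
of `Y₁` on which the two interferences agree, which gives `n₁ - lo`. -/

theorem mutualInfoBits_eq_zero_of_product {ω ζ : Type*} [Fintype ω] [Fintype ζ]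
    (a : ω → ℝ) (f : ζ → ℝ) (ha : ∑ w, a w = 1) (hf : ∑ z, f z = 1) :
    mutualInfoBits (fun w z => a w * f z) = 0 := by
  have h1 : ∀ w, ∑ z, a w * f z = a w := fun w => by rw [← Finset.mul_sum, hf, mul_one]
  have h2 : ∀ z, ∑ w, a w * f z = f z := fun z => by rw [← Finset.sum_mul, ha, one_mul]
  simp only [mutualInfoBits, entropyBits, h1, h2, ← Finset.sum_div, Fintype.sum_prod_type,
    Real.negMulLog_mul, Finset.sum_add_distrib, ← Finset.sum_mul, ← Finset.mul_sum, ha, hf]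
  ring

/-- This is `log x ≤ x - 1` at `x = P r / p`, the pointwise Gibbs inequality: `p` is a joint mass,
`P` the marginal of the observation and `r` a trial posterior. -/
theorem gibbs_term {p P r : ℝ} (hp : 0 ≤ p) (hP : p ≤ P) (hr : 0 < r) :
    p - P * r + p * Real.log r ≤ p * Real.log P⁻¹ - Real.negMulLog p := by
  rcases hp.eq_or_lt with rfl | hp
  · simp; positivity
  · have hP0 : 0 < P := hp.trans_le hP
    have h := Real.log_le_sub_one_of_pos (x := P * r / p) (by positivity)
    rw [Real.log_div (by positivity) hp.ne', Real.log_mul hP0.ne' hr.ne'] at h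
    have h2 := mul_le_mul_of_nonneg_left h hp.le
    have h3 : p * (P * r / p - 1) = P * r - p := by field_simp
    rw [h3] at h2
    rw [Real.log_inv, Real.negMulLog]
    linarith

/-- A list-decoding form of Fano's inequality: an observation `z` from which one can produce a list
of at most `K` candidates for a uniform message carries nearly `log M - log K` bits about it. -/
theorem list_fano {ζ : Type*} [Fintype ζ] {M K : ℕ} (hM : 0 < M) (hK : 0 < K)
    (p : Fin M → ζ → ℝ) (hp : ∀ w z, 0 ≤ p w z) (hunif : ∀ w, ∑ z, p w z = 1 / M)
    (L : ζ → Finset (Fin M)) (hL : ∀ z, (L z).card ≤ K) :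
    (∑ w, ∑ z, if w ∈ L z then p w z else 0) * (Real.logb 2 M - Real.logb 2 K) - 1
      ≤ mutualInfoBits p := by
  have hM' : (0 : ℝ) < M := by exact_mod_cast hM
  have hK' : (0 : ℝ) < K := by exact_mod_cast hK
  have hl2 : 0 < Real.log 2 := Real.log_pos one_lt_two
  have htot : ∑ w, ∑ z, p w z = 1 := by simp [hunif, hM'.ne']
  let P : ζ → ℝ := fun z => ∑ w, p w z
  have hPtot : ∑ z, P z = 1 := by rw [← htot]; exact Finset.sum_comm
  have hP0 : ∀ z, 0 ≤ P z := fun z => Finset.sum_nonneg fun w _ => hp w z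
  -- The trial posterior is an equal mixture of `1/K` on the list and the uniform law. The uniform
  -- part keeps it positive off the list; the factor `1/2` costs the one bit in the bound.
  let r : Fin M → ζ → ℝ := fun w z => 1 / 2 * ((if w ∈ L z then 1 / (K : ℝ) else 0) + 1 / M)
  have hr : ∀ w z, 0 < r w z := fun w z => by
    have : (0 : ℝ) ≤ if w ∈ L z then 1 / (K : ℝ) else 0 := by split_ifs <;> positivity
    have : (0 : ℝ) < 1 / M := by positivity
    simp only [r]; linarith
  -- A list shorter than `K` leaves total mass below one, which Gibbs' inequality tolerates.
  have hrsum : ∀ z, ∑ w, r w z ≤ 1 := fun z => by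
    simp only [r, ← Finset.mul_sum, Finset.sum_add_distrib, Finset.sum_ite_mem, Finset.univ_inter,
      Finset.sum_const, nsmul_eq_mul, Finset.card_univ, Fintype.card_fin]
    have h1 : ((L z).card : ℝ) * (1 / K) ≤ 1 := by
      rw [mul_one_div, div_le_one hK']; exact_mod_cast hL z
    have h2 : (M : ℝ) * (1 / M) = 1 := by field_simp
    linarith
  have hlog : ∀ w z, (if w ∈ L z then p w z else 0) * (Real.log M - Real.log K)
      - p w z * (Real.log 2 + Real.log M) ≤ p w z * Real.log (r w z) := fun w z => by
    split_ifs with h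
    · have : Real.log (1 / 2 * (1 / K)) ≤ Real.log (r w z) := by
        apply Real.log_le_log (by positivity)
        have : (0 : ℝ) < 1 / M := by positivity
        simp only [r, if_pos h]; linarith
      rw [Real.log_mul (by norm_num) (by positivity), one_div, one_div, Real.log_inv,
        Real.log_inv] at this
      have := mul_le_mul_of_nonneg_left this (hp w z)
      linarith
    · have : r w z = 1 / 2 * (1 / M) := by simp [r, h]
      rw [this, Real.log_mul (by norm_num) (by positivity), one_div, one_div, Real.log_inv,
        Real.log_inv]
      linarith
  have hsum : ∑ w, ∑ z, (p w z - P z * r w z + p w z * Real.log (r w z)) ≤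
      ∑ w, ∑ z, (p w z * Real.log (P z)⁻¹ - Real.negMulLog (p w z)) :=
    Finset.sum_le_sum fun w _ => Finset.sum_le_sum fun z _ =>
      gibbs_term (hp w z) (Finset.single_le_sum (f := fun w => p w z) (fun w _ => hp w z)
        (Finset.mem_univ w)) (hr w z)
  have hPr : ∑ w, ∑ z, P z * r w z ≤ 1 := by
    rw [Finset.sum_comm, ← hPtot]
    refine Finset.sum_le_sum fun z _ => ?_
    rw [← Finset.mul_sum]
    exact mul_le_of_le_one_right (hP0 z) (hrsum z)
  have hlogs := Finset.sum_le_sum fun w (_ : w ∈ Finset.univ) =>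
    Finset.sum_le_sum fun z (_ : z ∈ Finset.univ) => hlog w z
  simp only [Finset.sum_sub_distrib, ← Finset.sum_mul, htot, Finset.sum_add_distrib] at hlogs hsum
  have hHz : ∑ w, ∑ z, p w z * Real.log (P z)⁻¹ = ∑ z, Real.negMulLog (P z) := by
    rw [Finset.sum_comm]
    refine Finset.sum_congr rfl fun z _ => ?_
    rw [← Finset.sum_mul, Real.log_inv, Real.negMulLog]
    simp only [P]; ring
  have hHw : ∑ w : Fin M, Real.negMulLog (∑ z, p w z) = Real.log M := by
    simp only [hunif, Real.negMulLog, one_div, Real.log_inv, Finset.sum_const, Finset.card_univ,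
      Fintype.card_fin, nsmul_eq_mul]
    field_simp
  rw [hHz] at hsum
  have hI : mutualInfoBits p = (Real.log M + ∑ z, Real.negMulLog (P z)
      - ∑ w, ∑ z, Real.negMulLog (p w z)) / Real.log 2 := by
    simp only [mutualInfoBits, entropyBits, ← Finset.sum_div, hHw, Fintype.sum_prod_type, P]
    ring
  rw [hI, le_div_iff₀ hl2, Real.logb, Real.logb, ← sub_div, sub_mul, mul_assoc,
    div_mul_cancel₀ _ hl2.ne']
  linarith

/-! ### Deterministic wiretap channels with uniform state -/

section Deterministic

variable {X S Y₁ Y₂ : Type*} [Fintype S] [Nonempty S]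

/-- The channel with uniform state whose outputs are the functions `f₁`, `f₂` of input and state. -/
noncomputable def detChannel (f₁ : X → S → Y₁) (f₂ : X → S → Y₂) : WiretapChannel X S Y₁ Y₂ where
  stateLaw := PMF.uniformOfFintype S
  transition x s := PMF.pure (f₁ x s, f₂ x s)

theorem PMF.sum_toReal {α : Type*} [Fintype α] (p : PMF α) : ∑ a, (p a).toReal = 1 := by
  rw [← ENNReal.toReal_sum fun a _ => p.apply_ne_top a, ← tsum_fintype (L := .unconditional _),
    p.tsum_coe, ENNReal.toReal_one]

/-! ### Message and observation laws of a code over a deterministic channel -/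

namespace WiretapCode

variable {n : ℕ} (c : WiretapCode X S Y₁ n) (f₁ : X → S → Y₁) (f₂ : X → S → Y₂)

/-- The joint law of message, state block and input block for a uniform state. -/
noncomputable def inputLaw (w : Fin c.numMsg) (s : Fin n → S) (x : Fin n → X) : ℝ :=
  1 / (c.numMsg : ℝ) * (1 / (Fintype.card S : ℝ) ^ n) * (c.encoder w s x).toReal

theorem inputLaw_nonneg (w : Fin c.numMsg) (s : Fin n → S) (x : Fin n → X) :
    0 ≤ c.inputLaw w s x := by
  unfold inputLaw; positivity

open Classical in
theorem jointLaw_detChannel (w : Fin c.numMsg) (s : Fin n → S) (x : Fin n → X)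
    (y₁ : Fin n → Y₁) (y₂ : Fin n → Y₂) :
    c.jointLaw (detChannel f₁ f₂) w s x y₁ y₂ =
      if (fun i => f₁ (x i) (s i)) = y₁ then
        if (fun i => f₂ (x i) (s i)) = y₂ then c.inputLaw w s x else 0 else 0 := by
  have hs : ∏ i, ((detChannel f₁ f₂).stateLaw (s i)).toReal = 1 / (Fintype.card S : ℝ) ^ n := by
    simp [detChannel]
  have ht : ∏ i, ((detChannel f₁ f₂).transition (x i) (s i) (y₁ i, y₂ i)).toReal =
      if (fun i => f₁ (x i) (s i)) = y₁ then
        if (fun i => f₂ (x i) (s i)) = y₂ then (1 : ℝ) else 0 else 0 := by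
    simp only [detChannel, PMF.pure_apply, Prod.mk.injEq]
    by_cases h : ∀ i, f₁ (x i) (s i) = y₁ i ∧ f₂ (x i) (s i) = y₂ i
    · rw [if_pos (funext fun i => (h i).1), if_pos (funext fun i => (h i).2)]
      exact Finset.prod_eq_one fun i _ => by simp [h i]
    · obtain ⟨i, hi⟩ := not_forall.1 h
      have : ¬ ((fun i => f₁ (x i) (s i)) = y₁ ∧ (fun i => f₂ (x i) (s i)) = y₂) :=
        fun h' => hi ⟨congrFun h'.1 i, congrFun h'.2 i⟩
      rw [Finset.prod_eq_zero (Finset.mem_univ i), ← ite_and, if_neg this]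
      rw [if_neg fun h' => hi ⟨h'.1.symm, h'.2.symm⟩, ENNReal.toReal_zero]
  rw [jointLaw, hs, ht, inputLaw]
  split_ifs <;> simp

variable [Fintype X]

omit [Nonempty S] in
theorem sum_inputLaw_input (w : Fin c.numMsg) (s : Fin n → S) :
    ∑ x, c.inputLaw w s x = 1 / (c.numMsg : ℝ) * (1 / (Fintype.card S : ℝ) ^ n) := by
  simp only [inputLaw, ← Finset.mul_sum, PMF.sum_toReal, mul_one]

theorem sum_inputLaw (w : Fin c.numMsg) : ∑ s, ∑ x, c.inputLaw w s x = 1 / (c.numMsg : ℝ) := by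
  classical
  have : (Fintype.card S : ℝ) ≠ 0 := by exact_mod_cast Fintype.card_ne_zero
  simp only [sum_inputLaw_input, Finset.sum_const, Finset.card_univ, Fintype.card_pi,
    Finset.prod_const, Fintype.card_fin, nsmul_eq_mul, Nat.cast_pow]
  field_simp

open Classical in
/-- The joint law of the message and of an observation `o` of state and input. -/
noncomputable def obsLaw {ζ : Type*} (o : (Fin n → S) → (Fin n → X) → ζ)
    (w : Fin c.numMsg) (z : ζ) : ℝ :=
  ∑ s, ∑ x, if o s x = z then c.inputLaw w s x else 0

omit [Nonempty S] in
theorem sum_obsLaw_mul {ζ : Type*} [Fintype ζ] (o : (Fin n → S) → (Fin n → X) → ζ)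
    (w : Fin c.numMsg) (g : ζ → Prop) [DecidablePred g] :
    ∑ z, (if g z then c.obsLaw o w z else 0) =
      ∑ s, ∑ x, if g (o s x) then c.inputLaw w s x else 0 := by
  classical
  have : ∀ z, (if g z then c.obsLaw o w z else 0) =
      ∑ s, ∑ x, if o s x = z then (if g z then c.inputLaw w s x else 0) else 0 := fun z => by
    unfold obsLaw; split_ifs <;> simp
  simp only [this]
  rw [Finset.sum_comm]
  refine Finset.sum_congr rfl fun s _ => ?_
  rw [Finset.sum_comm]
  exact Finset.sum_congr rfl fun x _ => by simp

theorem sum_obsLaw {ζ : Type*} [Fintype ζ] (o : (Fin n → S) → (Fin n → X) → ζ)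
    (w : Fin c.numMsg) : ∑ z, c.obsLaw o w z = 1 / c.numMsg := by
  have := c.sum_obsLaw_mul o w fun _ => True
  simpa [sum_inputLaw] using this

theorem obsLaw_nonneg {ζ : Type*} (o : (Fin n → S) → (Fin n → X) → ζ)
    (w : Fin c.numMsg) (z : ζ) : 0 ≤ c.obsLaw o w z := by
  unfold obsLaw
  refine Finset.sum_nonneg fun s _ => Finset.sum_nonneg fun x _ => ?_
  split_ifs
  exacts [c.inputLaw_nonneg w s x, le_rfl]

theorem mutualInfoBits_state :
    mutualInfoBits (c.obsLaw fun s (_ : Fin n → X) => s) = 0 := by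
  classical
  have hM : (c.numMsg : ℝ) ≠ 0 := by exact_mod_cast c.numMsg_pos.ne'
  have hS : (Fintype.card S : ℝ) ≠ 0 := by exact_mod_cast Fintype.card_ne_zero
  have : c.obsLaw (fun s (_ : Fin n → X) => s) =
      fun _ _ => 1 / (c.numMsg : ℝ) * (1 / (Fintype.card S : ℝ) ^ n) := by
    ext w z
    unfold obsLaw
    rw [Finset.sum_eq_single z]
    · simp only [if_true]
      exact c.sum_inputLaw_input w z
    · intro s _ h
      simp [h]
    · simp
  rw [this]
  apply mutualInfoBits_eq_zero_of_product (fun _ => 1 / (c.numMsg : ℝ))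
    (fun _ => 1 / (Fintype.card S : ℝ) ^ n)
  · simp [hM]
  · simp [hS]

variable [Fintype Y₁] [Fintype Y₂]

open Classical in
theorem errorProb_detChannel : c.errorProb (detChannel f₁ f₂) =
    ∑ w, ∑ s, ∑ x, if c.decoder (fun i => f₁ (x i) (s i)) ≠ w then c.inputLaw w s x else 0 := by
  unfold errorProb
  refine Finset.sum_congr rfl fun w _ => Finset.sum_congr rfl fun s _ =>
    Finset.sum_congr rfl fun x _ => ?_
  rw [Finset.sum_eq_single (fun i => f₁ (x i) (s i))]
  · rw [Finset.sum_eq_single (fun i => f₂ (x i) (s i))]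
    · simp [jointLaw_detChannel]
    · intro y₂ _ h
      simp [jointLaw_detChannel, h.symm]
    · simp
  · intro y₁ _ h
    simp [jointLaw_detChannel, h.symm]
  · simp

theorem leakage_detChannel : c.leakage (detChannel f₁ f₂) =
    mutualInfoBits (c.obsLaw fun s x i => f₂ (x i) (s i)) := by
  classical
  unfold leakage
  congr 1
  ext w y₂
  unfold obsLaw
  refine Finset.sum_congr rfl fun s _ => Finset.sum_congr rfl fun x _ => ?_
  rw [Finset.sum_eq_single (fun i => f₁ (x i) (s i))]
  · simp [jointLaw_detChannel]
  · intro y₁ _ h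
    simp [jointLaw_detChannel, h.symm]
  · simp

/-- If the receiver's output is determined by an observation and one of `|V|` symbols per channel
use, then that observation reveals all but `log |V|` bits per use of a decodable message. -/
theorem information_lower_bound {ζ V : Type*} [Fintype ζ] [Fintype V] [Nonempty V]
    (o : (Fin n → S) → (Fin n → X) → ζ) (Φ : ζ → (Fin n → V) → Fin n → Y₁)
    (hΦ : ∀ s x, ∃ v, (fun i => f₁ (x i) (s i)) = Φ (o s x) v) :
    (1 - c.errorProb (detChannel f₁ f₂)) *
        (Real.logb 2 c.numMsg - n * Real.logb 2 (Fintype.card V)) - 1 ≤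
      max 0 (mutualInfoBits (c.obsLaw o)) := by
  classical
  -- The candidates are what the decoder outputs over all `|V| ^ n` completions of the observation;
  -- they include `w` whenever decoding succeeds.
  let L : ζ → Finset (Fin c.numMsg) := fun z => Finset.univ.image fun v => c.decoder (Φ z v)
  have hL : ∀ z, (L z).card ≤ Fintype.card V ^ n := fun z =>
    Finset.card_image_le.trans (by simp)
  have hf := list_fano c.numMsg_pos (pow_pos (Fintype.card_pos (α := V)) n) (c.obsLaw o)
    (c.obsLaw_nonneg o) (c.sum_obsLaw o) L hL
  have hM : (c.numMsg : ℝ) ≠ 0 := by exact_mod_cast c.numMsg_pos.ne'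
  have htot : ∑ w, ∑ s, ∑ x, c.inputLaw w s x = 1 := by simp [sum_inputLaw, hM]
  have hE : 1 - c.errorProb (detChannel f₁ f₂) ≤
      ∑ w, ∑ z, if w ∈ L z then c.obsLaw o w z else 0 := by
    rw [errorProb_detChannel, ← htot, ← Finset.sum_sub_distrib]
    refine Finset.sum_le_sum fun w _ => ?_
    rw [← Finset.sum_sub_distrib, c.sum_obsLaw_mul o w fun z => w ∈ L z]
    refine Finset.sum_le_sum fun s _ => ?_
    rw [← Finset.sum_sub_distrib]
    refine Finset.sum_le_sum fun x _ => ?_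
    have h0 := c.inputLaw_nonneg w s x
    by_cases hd : c.decoder (fun i => f₁ (x i) (s i)) = w
    · have : w ∈ L (o s x) := by
        obtain ⟨v, hv⟩ := hΦ s x
        exact Finset.mem_image.2 ⟨v, Finset.mem_univ _, by rw [← hv, hd]⟩
      simp [hd, this]
    · simp only [ne_eq, hd, not_false_eq_true, if_true, sub_self]
      split_ifs
      exacts [h0, le_rfl]
  have hK : Real.logb 2 ((Fintype.card V ^ n : ℕ) : ℝ) = n * Real.logb 2 (Fintype.card V) := by
    push_cast; exact Real.logb_pow _ _ _
  rw [hK] at hf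
  -- Replacing the list probability by the smaller `1 - errorProb` is valid only if the rate gap is
  -- nonnegative. Otherwise the left side is negative, whence the `max 0`.
  rcases le_total 0 (Real.logb 2 c.numMsg - n * Real.logb 2 (Fintype.card V)) with h | h
  · exact ((sub_le_sub_right (mul_le_mul_of_nonneg_right hE h) 1).trans hf).trans (le_max_right _ _)
  · refine le_trans ?_ (le_max_left _ _)
    have : c.errorProb (detChannel f₁ f₂) ≤ 1 := by
      rw [errorProb_detChannel, ← htot]
      refine Finset.sum_le_sum fun w _ => Finset.sum_le_sum fun s _ =>
        Finset.sum_le_sum fun x _ => ?_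
      split_ifs
      exacts [le_rfl, c.inputLaw_nonneg w s x]
    nlinarith [mul_nonneg (sub_nonneg.2 this) (neg_nonneg.2 h)]

end WiretapCode

/-! ### Single-letter converse and achievability criteria -/

namespace WiretapChannel

variable [Fintype X] [Fintype Y₁] [Fintype Y₂]

theorem rate_le_of_information_bound {f₁ : X → S → Y₁} {f₂ : X → S → Y₂} {R κ : ℝ}
    (c : (n : ℕ) → WiretapCode X S Y₁ n)
    (hrate : ∀ ε : ℝ, 0 < ε → ∀ᶠ n in atTop, R - ε ≤ (c n).rate)
    (herr : Tendsto (fun n => (c n).errorProb (detChannel f₁ f₂)) atTop (𝓝 0))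
    (I : ℕ → ℝ) (hI : Tendsto (fun n => I n / n) atTop (𝓝 0))
    (h : ∀ n, (1 - (c n).errorProb (detChannel f₁ f₂)) *
      (Real.logb 2 (c n).numMsg - n * κ) - 1 ≤ max 0 (I n)) : R ≤ κ := by
  by_contra! hlt
  -- With slack `(R - κ) / 2` the hypothesis, divided by `n`, makes this sequence eventually
  -- nonnegative, while its limit is `-(R - κ) / 2 < 0`.
  have hlim : Tendsto (fun n : ℕ => max 0 (I n / n) - (1 - (c n).errorProb (detChannel f₁ f₂)) *
      ((R - κ) / 2) + 1 / n) atTop (𝓝 (max 0 0 - (1 - 0) * ((R - κ) / 2) + 0)) :=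
    (((tendsto_const_nhds.max hI)).sub ((tendsto_const_nhds.sub herr).mul_const _)).add
      tendsto_one_div_atTop_nhds_zero_nat
  have hge : 0 ≤ max 0 0 - (1 - 0) * ((R - κ) / 2) + 0 := by
    refine ge_of_tendsto hlim ?_
    filter_upwards [hrate ((R - κ) / 2) (by linarith), eventually_gt_atTop 0,
      herr.eventually_lt_const one_pos] with n hn hn0 he
    have hn' : (0 : ℝ) < n := by exact_mod_cast hn0
    rw [WiretapCode.rate, le_div_iff₀ hn'] at hn
    have h1 := mul_le_mul_of_nonneg_left (show n * ((R - κ) / 2) ≤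
      Real.logb 2 (c n).numMsg - n * κ by linarith) (sub_nonneg.2 he.le)
    have h2 := h n
    have h3 : max 0 (I n / n) = max 0 (I n) / n := by
      rw [← max_div_div_right hn'.le, zero_div]
    have h4 : max 0 (I n) / n - (1 - (c n).errorProb (detChannel f₁ f₂)) * ((R - κ) / 2) + 1 / n =
      (max 0 (I n) - (1 - (c n).errorProb (detChannel f₁ f₂)) * (n * ((R - κ) / 2)) + 1) / n := by
      field_simp
    rw [h3, h4]
    exact div_nonneg (by linarith) hn'.le
  norm_num at hge
  linarith

/-- Converse: the eavesdropper knows everything about `Y₁` but one of `|V|` symbols. -/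
theorem Achievable.le_of_eavesdropper {f₁ : X → S → Y₁} {f₂ : X → S → Y₂} {R : ℝ}
    (hR : (detChannel f₁ f₂).Achievable R) {V : Type*} [Fintype V] [Nonempty V]
    (Φ : Y₂ → V → Y₁) (hΦ : ∀ x s, ∃ v, f₁ x s = Φ (f₂ x s) v) :
    R ≤ Real.logb 2 (Fintype.card V) := by
  obtain ⟨c, hrate, herr, hleak⟩ := hR
  refine rate_le_of_information_bound c hrate herr _ hleak fun n => ?_
  rw [WiretapCode.leakage_detChannel]
  refine (c n).information_lower_bound f₁ f₂ _ (fun z v i => Φ (z i) (v i)) fun s x => ?_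
  choose v hv using fun i => hΦ (x i) (s i)
  exact ⟨v, funext hv⟩

/-- Converse: given the state, `Y₁` takes at most `|V|` values. -/
theorem Achievable.le_of_state {f₁ : X → S → Y₁} {f₂ : X → S → Y₂} {R : ℝ}
    (hR : (detChannel f₁ f₂).Achievable R) {V : Type*} [Fintype V] [Nonempty V]
    (Φ : S → V → Y₁) (hΦ : ∀ x s, ∃ v, f₁ x s = Φ s v) :
    R ≤ Real.logb 2 (Fintype.card V) := by
  obtain ⟨c, hrate, herr, -⟩ := hR
  refine rate_le_of_information_bound c hrate herr (fun _ => 0) (by simp) fun n => ?_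
  have h := (c n).information_lower_bound f₁ f₂ (fun s _ => s) (fun z v i => Φ (z i) (v i))
    fun s x => by
      choose v hv using fun i => hΦ (x i) (s i)
      exact ⟨v, funext hv⟩
  rwa [WiretapCode.mutualInfoBits_state] at h

/-- Achievability from a single-letter scheme with perfect decoding and perfect secrecy: for every
message some relabelling of the states gives the eavesdropper the same output. -/
theorem achievable_of_scheme {f₁ : X → S → Y₁} {f₂ : X → S → Y₂} {V : Type*} [Fintype V]
    [Nonempty V] (enc : V → S → X) (dec : Y₁ → V) (hdec : ∀ w s, dec (f₁ (enc w s) s) = w)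
    (σ : V → Equiv.Perm S) (g : S → Y₂) (hσ : ∀ w s, f₂ (enc w (σ w s)) (σ w s) = g s) :
    (detChannel f₁ f₂).Achievable (Real.logb 2 (Fintype.card V)) := by
  classical
  let e : (n : ℕ) → Fin (Fintype.card V ^ n) ≃ (Fin n → V) := fun n =>
    (Fintype.equivFinOfCardEq (by simp)).symm
  let c : (n : ℕ) → WiretapCode X S Y₁ n := fun n =>
    { numMsg := Fintype.card V ^ n
      numMsg_pos := pow_pos Fintype.card_pos n
      encoder := fun w s => PMF.pure fun i => enc (e n w i) (s i)
      decoder := fun y => (e n).symm fun i => dec (y i) }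
  have hin : ∀ n w s x, (c n).inputLaw w s x = if x = (fun i => enc (e n w i) (s i)) then
      1 / ((c n).numMsg : ℝ) * (1 / (Fintype.card S : ℝ) ^ n) else 0 := fun n w s x => by
    simp only [WiretapCode.inputLaw, c, PMF.pure_apply]
    split_ifs <;> simp
  refine ⟨c, fun ε hε => ?_, ?_, ?_⟩
  · filter_upwards [eventually_gt_atTop 0] with n hn
    have hn' : (n : ℝ) ≠ 0 := by exact_mod_cast hn.ne'
    have : (c n).rate = Real.logb 2 (Fintype.card V) := by
      simp only [WiretapCode.rate, c]
      push_cast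
      rw [Real.logb_pow]
      field_simp
    linarith
  · refine tendsto_const_nhds.congr fun n => ?_
    rw [WiretapCode.errorProb_detChannel]
    refine (Finset.sum_eq_zero fun w _ => Finset.sum_eq_zero fun s _ =>
      Finset.sum_eq_zero fun x _ => ?_).symm
    rw [hin]
    by_cases hx : x = fun i => enc (e n w i) (s i)
    · have : (c n).decoder (fun i => f₁ (x i) (s i)) = w := by
        simp [c, hx, hdec]
      simp [this]
    · simp [hx]
  · refine tendsto_const_nhds.congr fun n => ?_
    have hM : ((c n).numMsg : ℝ) ≠ 0 := by exact_mod_cast (c n).numMsg_pos.ne'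
    let f : (Fin n → Y₂) → ℝ := fun y =>
      ∑ s : Fin n → S, if (fun i => g (s i)) = y then 1 / (Fintype.card S : ℝ) ^ n else 0
    have hobs : (c n).obsLaw (fun s x i => f₂ (x i) (s i)) =
        fun _ y => 1 / ((c n).numMsg : ℝ) * f y := by
      ext w y
      simp only [WiretapCode.obsLaw, f, Finset.mul_sum]
      -- The uniform state law is invariant under the coordinatewise relabelling, after which the
      -- message no longer affects the eavesdropper's output.
      rw [← (Equiv.piCongrRight fun i => σ (e n w i)).sum_comp]
      refine Finset.sum_congr rfl fun s _ => ?_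
      rw [Finset.sum_eq_single fun i => enc (e n w i) (σ (e n w i) (s i))]
      · simp [hin, hσ]
      · intro x _ hx
        rw [hin]
        split_ifs with _ h
        exacts [absurd h hx, rfl, rfl]
      · simp
    have hf : ∑ y, f y = 1 := by
      have h := (c n).sum_obsLaw (fun s x i => f₂ (x i) (s i)) ⟨0, (c n).numMsg_pos⟩
      rw [hobs, ← Finset.mul_sum] at h
      exact mul_left_cancel₀ (one_div_ne_zero hM) (h.trans (mul_one _).symm)
    rw [WiretapCode.leakage_detChannel, hobs,
      mutualInfoBits_eq_zero_of_product (fun _ => 1 / ((c n).numMsg : ℝ)) f _ hf, zero_div]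
    simp [hM]

end WiretapChannel

end Deterministic

/-! ### The linear deterministic model -/

/-- Extension by zero of a binary vector to all integer positions. -/
def zeroExtend {k : ℕ} (v : BinVec k) (j : ℤ) : ZMod 2 :=
  if h : 0 ≤ j ∧ j < k then v ⟨j.toNat, by omega⟩ else 0

section zeroExtend

variable {k : ℕ}

theorem zeroExtend_of_neg (v : BinVec k) {j : ℤ} (h : j < 0) : zeroExtend v j = 0 :=
  dif_neg (by omega)

theorem zeroExtend_of_mem (v : BinVec k) {j : ℤ} (h : 0 ≤ j) (h' : j < k) :
    zeroExtend v j = v ⟨j.toNat, by omega⟩ :=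
  dif_pos ⟨h, h'⟩

theorem zeroExtend_coe (v : BinVec k) (j : Fin k) : zeroExtend v (j : ℕ) = v j := by
  rw [zeroExtend_of_mem v (by omega) (by omega)]; simp

theorem zeroExtend_add (u v : BinVec k) (j : ℤ) :
    zeroExtend (u + v) j = zeroExtend u j + zeroExtend v j := by
  unfold zeroExtend; split_ifs <;> simp

theorem zeroExtend_zero (j : ℤ) : zeroExtend (0 : BinVec k) j = 0 := by
  unfold zeroExtend; split_ifs <;> simp

theorem zeroExtend_ofFn (f : ℤ → ZMod 2) {j : ℤ} (h : 0 ≤ j) (h' : j < k) :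
    zeroExtend (fun i : Fin k => f (i : ℕ)) j = f j := by
  rw [zeroExtend_of_mem _ h h']; simp [Int.toNat_of_nonneg h]

end zeroExtend

theorem downShift_mulVec {q : ℕ} (x : BinVec q) (j : Fin q) :
    Matrix.mulVec (downShift q) x j = zeroExtend x ((j : ℕ) - 1 : ℤ) := by
  simp only [Matrix.mulVec, dotProduct, downShift, Matrix.of_apply, ite_mul, one_mul, zero_mul]
  by_cases hj : (j : ℕ) = 0
  · rw [zeroExtend_of_neg _ (by omega)]
    exact Finset.sum_eq_zero fun k _ => if_neg (by omega)
  · rw [zeroExtend_of_mem _ (by omega) (by omega),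
      Finset.sum_eq_single ⟨((j : ℕ) - 1 : ℤ).toNat, by omega⟩]
    · exact if_pos (by simp; omega)
    · intro k _ hk
      refine if_neg fun h => hk (Fin.ext ?_)
      simp; omega
    · simp

theorem downShift_pow_mulVec {q : ℕ} (k : ℕ) (x : BinVec q) (j : Fin q) :
    Matrix.mulVec (downShift q ^ k) x j = zeroExtend x ((j : ℕ) - k : ℤ) := by
  induction k generalizing j with
  | zero => simp [zeroExtend_coe]
  | succ k ih =>
    rw [pow_succ', ← Matrix.mulVec_mulVec, downShift_mulVec]
    by_cases hj : (j : ℕ) = 0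
    · rw [zeroExtend_of_neg _ (by omega), zeroExtend_of_neg _ (by omega)]
    · rw [zeroExtend_of_mem _ (by omega) (by omega), ih]
      congr 1
      push_cast
      omega

section Output

variable {q n m : ℕ}

/-- Relative to the input index `j - q + n`, the interference is displaced by `m - n` alone;
extension by zero accounts for truncation. -/
theorem linDetOutput_apply (hn : n ≤ q) (hm : m ≤ q) (x s : BinVec q) (j : Fin q) :
    linDetOutput q n m x s j =
      zeroExtend x ((j : ℕ) - q + n : ℤ) + zeroExtend s ((j : ℕ) - q + n + ((m : ℤ) - n)) := by
  rw [linDetOutput, Pi.add_apply, downShift_pow_mulVec, downShift_pow_mulVec]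
  congr 2 <;> omega

/-- The output row carrying input bit `i`. -/
theorem zeroExtend_linDetOutput (hn : n ≤ q) (hm : m ≤ q) (x s : BinVec q) {i : ℤ} (hi : i < n) :
    zeroExtend (linDetOutput q n m x s) (i + q - n) =
      zeroExtend x i + zeroExtend s (i + ((m : ℤ) - n)) := by
  by_cases h : 0 ≤ i + q - n
  · rw [zeroExtend_of_mem _ h (by omega), linDetOutput_apply hn hm]
    congr 2 <;> simp only [] <;> omega
  · rw [zeroExtend_of_neg _ (by omega), zeroExtend_of_neg _ (by omega),
      zeroExtend_of_neg _ (by omega), add_zero]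

end Output

/-- A triangular linear recursion over `𝔽₂` with two distinct shifts is solvable. -/
theorem exists_two_shift_solution {c e : ℤ} (hec : e < c) (lo : ℤ) (f : ℤ → ZMod 2) :
    ∃ u : ℤ → ZMod 2, (∀ j < lo + c, u j = 0) ∧ ∀ i, lo ≤ i → f i + u (i + c) + u (i + e) = 0 := by
  -- `v k` stands for `u (lo + c + k)`: the equation at `i = lo + k` is solved for its higher entry,
  -- in terms of the one `c - e` places below.
  have hv : ∃ v : ℕ → ZMod 2, ∀ k, v k = f (lo + k) +
      if (c - e).toNat ≤ k then v (k - (c - e).toNat) else 0 := by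
    let v : ℕ → ZMod 2 := WellFounded.fix Nat.lt_wfRel.wf fun k rec =>
      f (lo + k) + if h : (c - e).toNat ≤ k then
        rec (k - (c - e).toNat) (show k - (c - e).toNat < k by omega) else 0
    refine ⟨v, fun k => ?_⟩
    simp only [v]
    rw [WellFounded.fix_eq]
    simp only [dite_eq_ite]
  obtain ⟨v, hv⟩ := hv
  refine ⟨fun j => if j < lo + c then 0 else v (j - (lo + c)).toNat, fun j hj => if_pos hj,
    fun i hi => ?_⟩
  have h1 : ¬ i + c < lo + c := by omega
  have h2 : (i + c - (lo + c)).toNat = (i - lo).toNat := by omega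
  have h3 : lo + ((i - lo).toNat : ℤ) = i := by omega
  simp only [h1, if_false, h2]
  rw [hv, h3]
  by_cases h : i + e < lo + c
  · rw [if_neg (by omega), if_pos h, add_zero, add_zero, CharTwo.add_self_eq_zero]
  · have h4 : (i + e - (lo + c)).toNat = (i - lo).toNat - (c - e).toNat := by omega
    rw [if_pos (by omega), if_neg h, h4, ← add_assoc, CharTwo.add_self_eq_zero, zero_add,
      CharTwo.add_self_eq_zero]

/-- The interference-aligning encoder: bits below `lo` are unused, bits from `lo` to `n₁` carry the
message and cancel the interference at the receiver (shift `a`), and bits from `n₁` on cancel the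
interference at the eavesdropper (shift `b`). -/
def alignEncoder (q lo n₁ : ℕ) (a b : ℤ) (w : BinVec (n₁ - lo)) (s : BinVec q) : BinVec q :=
  fun i => if (i : ℕ) < lo then 0 else if (i : ℕ) < n₁ then
    zeroExtend w ((i : ℕ) - lo : ℤ) + zeroExtend s ((i : ℕ) + a) else zeroExtend s ((i : ℕ) + b)

/-! ### Aligned coding scheme and matching converses -/

section Scheme

variable {q n₁ m₁ n₂ m₂ lo : ℕ}

/-- The encoder is additive in message and state jointly, so if the pair `(w, t)` is invisible to
the eavesdropper, translating the state by `t` makes message `w` look like message `0`. -/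
theorem achievable_of_cancellation (hn₁ : n₁ ≤ q) (hm₁ : m₁ ≤ q) (hn₂ : n₂ ≤ q) (hm₂ : m₂ ≤ q)
    (hsol : ∀ w : BinVec (n₁ - lo), ∃ t : BinVec q, ∀ i : ℤ, i < n₂ →
      zeroExtend (alignEncoder q lo n₁ ((m₁ : ℤ) - n₁) ((m₂ : ℤ) - n₂) w t) i
        + zeroExtend t (i + ((m₂ : ℤ) - n₂)) = 0) :
    (detChannel (linDetOutput q n₁ m₁) (linDetOutput q n₂ m₂)).Achievable ((n₁ - lo : ℕ) : ℝ) := by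
  choose t ht using hsol
  have hcard : Real.logb 2 (Fintype.card (BinVec (n₁ - lo))) = ((n₁ - lo : ℕ) : ℝ) := by
    simp [Real.logb_pow]
  rw [← hcard]
  have hadd : ∀ w s i,
      zeroExtend (alignEncoder q lo n₁ ((m₁ : ℤ) - n₁) ((m₂ : ℤ) - n₂) w (s + t w)) i =
      zeroExtend (alignEncoder q lo n₁ ((m₁ : ℤ) - n₁) ((m₂ : ℤ) - n₂) 0 s) i +
      zeroExtend (alignEncoder q lo n₁ ((m₁ : ℤ) - n₁) ((m₂ : ℤ) - n₂) w (t w)) i := by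
    intro w s i
    rw [← zeroExtend_add]
    congr 1
    ext i
    simp only [alignEncoder, Pi.add_apply, zeroExtend_add, zeroExtend_zero]
    split_ifs <;> ring
  refine WiretapChannel.achievable_of_scheme
    (alignEncoder q lo n₁ ((m₁ : ℤ) - n₁) ((m₂ : ℤ) - n₂))
    (fun y l => zeroExtend y (((l : ℕ) + lo : ℤ) + q - n₁)) (fun w s => ?_)
    (fun w => Equiv.addRight (t w))
    (fun s => linDetOutput q n₂ m₂ (alignEncoder q lo n₁ ((m₁ : ℤ) - n₁) ((m₂ : ℤ) - n₂) 0 s) s)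
    (fun w s => ?_)
  · ext l
    have hl := l.2
    rw [zeroExtend_linDetOutput hn₁ hm₁ _ _ (by omega), zeroExtend_of_mem _ (by omega) (by omega)]
    have hl' : ((l : ℕ) + lo : ℤ).toNat = l + lo := by omega
    simp only [alignEncoder, hl']
    rw [if_neg (by omega), if_pos (by omega)]
    push_cast
    rw [add_sub_cancel_right, zeroExtend_coe, add_assoc, CharTwo.add_self_eq_zero, add_zero]
  · ext j
    have h := ht w ((j : ℕ) - q + n₂ : ℤ) (by omega)
    simp only [Equiv.coe_addRight, linDetOutput_apply hn₂ hm₂, zeroExtend_add, hadd]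
    rw [add_add_add_comm, h, add_zero]

/-- The condition on `lo` ensures that the recursion starts at a nonnegative position, so its
solution is an actual state vector. -/
theorem achievable_of_distinct_shifts (hn₁ : n₁ ≤ q) (hm₁ : m₁ ≤ q) (hn₂ : n₂ ≤ q) (hm₂ : m₂ ≤ q)
    (hne : (m₁ : ℤ) - n₁ ≠ (m₂ : ℤ) - n₂) (hlo : 0 ≤ lo + max ((m₁ : ℤ) - n₁) ((m₂ : ℤ) - n₂)) :
    (detChannel (linDetOutput q n₁ m₁) (linDetOutput q n₂ m₂)).Achievable ((n₁ - lo : ℕ) : ℝ) := by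
  refine achievable_of_cancellation hn₁ hm₁ hn₂ hm₂ fun w => ?_
  obtain ⟨u, hu0, hu⟩ : ∃ u : ℤ → ZMod 2,
      (∀ j < lo + max ((m₁ : ℤ) - n₁) ((m₂ : ℤ) - n₂), u j = 0) ∧ ∀ i : ℤ, lo ≤ i →
      zeroExtend w (i - lo) + u (i + ((m₁ : ℤ) - n₁)) + u (i + ((m₂ : ℤ) - n₂)) = 0 := by
    rcases lt_or_gt_of_ne hne with h | h
    · obtain ⟨u, h0, h1⟩ := exists_two_shift_solution h lo fun i => zeroExtend w (i - lo)
      rw [max_eq_right h.le]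
      exact ⟨u, h0, fun i hi => by rw [← h1 i hi]; ring⟩
    · obtain ⟨u, h0, h1⟩ := exists_two_shift_solution h lo fun i => zeroExtend w (i - lo)
      rw [max_eq_left h.le]
      exact ⟨u, h0, h1⟩
  -- Cutting `u` to length `q` loses nothing: it vanishes at negative positions, and positions read
  -- below stay under `m₁` or `m₂`, hence under `q`.
  have ht : ∀ j : ℤ, j < q → zeroExtend (fun i : Fin q => u (i : ℕ)) j = u j := fun j hj => by
    rcases lt_or_ge j 0 with h | h
    · rw [zeroExtend_of_neg _ h, hu0 j (by omega)]
    · exact zeroExtend_ofFn u h hj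
  refine ⟨fun i => u (i : ℕ), fun i hi => ?_⟩
  rw [ht (i + ((m₂ : ℤ) - n₂)) (by omega)]
  rcases lt_or_ge i 0 with h0 | h0
  · rw [zeroExtend_of_neg _ h0, zero_add, hu0 _ (by omega)]
  rw [zeroExtend_of_mem _ h0 (by omega)]
  simp only [alignEncoder, Int.toNat_of_nonneg h0]
  split_ifs with h1 h2
  · rw [zero_add, hu0 _ (by omega)]
  · rw [ht _ (by omega), hu i (by omega)]
  · rw [ht _ (by omega), CharTwo.add_self_eq_zero]

theorem achievable_eavesdropper_gap (hn₁ : n₁ ≤ q) (hm₁ : m₁ ≤ q) (hn₂ : n₂ ≤ q) (hm₂ : m₂ ≤ q) :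
    (detChannel (linDetOutput q n₁ m₁) (linDetOutput q n₂ m₂)).Achievable ((n₁ - n₂ : ℕ) : ℝ) := by
  refine achievable_of_cancellation hn₁ hm₁ hn₂ hm₂ fun w => ⟨0, fun i hi => ?_⟩
  rw [zeroExtend_zero, add_zero]
  rcases lt_or_ge i 0 with h0 | h0
  · exact zeroExtend_of_neg _ h0
  · rw [zeroExtend_of_mem _ h0 (by omega)]
    exact if_pos (by simp only []; omega)

theorem Achievable.le_receiver_gain (hn₁ : n₁ ≤ q) (hm₁ : m₁ ≤ q)
    {f₂ : BinVec q → BinVec q → BinVec q} {R : ℝ} (hR : (detChannel (linDetOutput q n₁ m₁) f₂).Achievable R) : R ≤ n₁ := by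
  have hcard : Real.logb 2 (Fintype.card (BinVec n₁)) = (n₁ : ℝ) := by simp [Real.logb_pow]
  rw [← hcard]
  refine hR.le_of_state (fun s (v : BinVec n₁) j => zeroExtend v ((j : ℕ) - q + n₁ : ℤ)
    + zeroExtend s ((j : ℕ) - q + n₁ + ((m₁ : ℤ) - n₁))) fun x s =>
      ⟨fun l => zeroExtend x (l : ℕ), funext fun j => ?_⟩
  rw [linDetOutput_apply hn₁ hm₁]
  congr 1
  rcases lt_or_ge ((j : ℕ) - q + n₁ : ℤ) 0 with h0 | h0
  · rw [zeroExtend_of_neg _ h0, zeroExtend_of_neg _ h0]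
  · exact (zeroExtend_ofFn (zeroExtend x) h0 (by omega)).symm

/-- On input bits below `lo` both interferences coincide, so the eavesdropper's rows equal the
receiver's; the remaining `n₁ - lo` rows form the unknown symbol. -/
theorem Achievable.le_private_bits (hn₁ : n₁ ≤ q) (hm₁ : m₁ ≤ q) (hn₂ : n₂ ≤ q) (hm₂ : m₂ ≤ q)
    (hlo : lo ≤ n₂)
    (hs : ∀ (s : BinVec q) (i : ℤ), i < lo →
      zeroExtend s (i + ((m₁ : ℤ) - n₁)) = zeroExtend s (i + ((m₂ : ℤ) - n₂)))
    {R : ℝ} (hR : (detChannel (linDetOutput q n₁ m₁) (linDetOutput q n₂ m₂)).Achievable R) :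
    R ≤ ((n₁ - lo : ℕ) : ℝ) := by
  have hcard : Real.logb 2 (Fintype.card (BinVec (n₁ - lo))) = ((n₁ - lo : ℕ) : ℝ) := by
    simp [Real.logb_pow]
  rw [← hcard]
  refine hR.le_of_eavesdropper (fun y (v : BinVec (n₁ - lo)) j =>
    if (j : ℕ) - q + n₁ < (lo : ℤ) then zeroExtend y ((j : ℕ) - q + n₁ + q - n₂ : ℤ)
    else zeroExtend v ((j : ℕ) - q + n₁ - lo : ℤ)) fun x s =>
      ⟨fun l => zeroExtend (linDetOutput q n₁ m₁ x s) (((l : ℕ) : ℤ) + lo + q - n₁),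
        funext fun j => ?_⟩
  split_ifs with h
  · rw [zeroExtend_linDetOutput hn₂ hm₂ _ _ (by omega), linDetOutput_apply hn₁ hm₁, hs s _ h]
  · rw [zeroExtend_ofFn (fun l => zeroExtend (linDetOutput q n₁ m₁ x s) (l + lo + q - n₁))
      (by omega) (by omega)]
    have : ((j : ℕ) - q + n₁ - lo + lo + q - n₁ : ℤ) = (j : ℕ) := by ring
    rw [this, zeroExtend_coe]

end Scheme

theorem linDetChannel_eq_detChannel (n₁ n₂ m₁ m₂ : ℕ) : linDetChannel n₁ n₂ m₁ m₂ =
    detChannel (linDetOutput (maxGain n₁ n₂ m₁ m₂) n₁ m₁)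
      (linDetOutput (maxGain n₁ n₂ m₁ m₂) n₂ m₂) := rfl

theorem theorem2 (n₁ n₂ m₁ m₂ : ℕ) :
    ((n₁ : ℤ) - m₁ ≠ (n₂ : ℤ) - m₂ → (n₁ ≤ m₁ ∨ n₂ ≤ m₂) →
      (linDetChannel n₁ n₂ m₁ m₂).IsSecrecyCapacity (n₁ : ℝ)) ∧
    ((n₁ : ℤ) - m₁ ≠ (n₂ : ℤ) - m₂ → (m₁ < n₁ ∧ m₂ < n₂) →
      (linDetChannel n₁ n₂ m₁ m₂).IsSecrecyCapacity (max (m₁ : ℝ) ((n₁ : ℝ) - n₂ + m₂))) ∧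
    ((n₁ : ℤ) - m₁ = (n₂ : ℤ) - m₂ →
      (linDetChannel n₁ n₂ m₁ m₂).IsSecrecyCapacity (max 0 ((n₁ : ℝ) - n₂))) := by
  have hn₁ : n₁ ≤ maxGain n₁ n₂ m₁ m₂ := by simp [maxGain]
  have hn₂ : n₂ ≤ maxGain n₁ n₂ m₁ m₂ := by simp [maxGain]
  have hm₁ : m₁ ≤ maxGain n₁ n₂ m₁ m₂ := by simp [maxGain]
  have hm₂ : m₂ ≤ maxGain n₁ n₂ m₁ m₂ := by simp [maxGain]
  rw [linDetChannel_eq_detChannel]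
  refine ⟨fun hne h => ⟨?_, fun R hR => Achievable.le_receiver_gain hn₁ hm₁ hR⟩,
    fun hne h => ?_, fun heq => ?_⟩
  · have := achievable_of_distinct_shifts (lo := 0) hn₁ hm₁ hn₂ hm₂ (by omega) (by omega)
    simpa using this
  -- Here `lo = min (n₁ - m₁) (n₂ - m₂)`, the number of top input bits that both terminals receive
  -- free of interference.
  · have hC : max (m₁ : ℝ) ((n₁ : ℝ) - n₂ + m₂) =
        ((n₁ - min (n₁ - m₁) (n₂ - m₂) : ℕ) : ℝ) := by
      have : max (m₁ : ℤ) ((n₁ : ℤ) - n₂ + m₂) =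
        ((n₁ - min (n₁ - m₁) (n₂ - m₂) : ℕ) : ℤ) := by omega
      exact_mod_cast congrArg (Int.cast : ℤ → ℝ) this
    rw [hC]
    refine ⟨achievable_of_distinct_shifts hn₁ hm₁ hn₂ hm₂ (by omega) (by omega), fun R hR =>
      Achievable.le_private_bits hn₁ hm₁ hn₂ hm₂ (by omega) (fun s i hi => ?_) hR⟩
    rw [zeroExtend_of_neg _ (by omega), zeroExtend_of_neg _ (by omega)]
  -- Equal shifts: `lo = n₂`, and truncated subtraction supplies the positive part.
  · have hC : max 0 ((n₁ : ℝ) - n₂) = ((n₁ - n₂ : ℕ) : ℝ) := by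
      have : max 0 ((n₁ : ℤ) - n₂) = ((n₁ - n₂ : ℕ) : ℤ) := by omega
      exact_mod_cast congrArg (Int.cast : ℤ → ℝ) this
    rw [hC]
    refine ⟨achievable_eavesdropper_gap hn₁ hm₁ hn₂ hm₂, fun R hR =>
      Achievable.le_private_bits hn₁ hm₁ hn₂ hm₂ le_rfl (fun s i _ => ?_) hR⟩
    congr 1
    omega
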